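/- All graphs are finite, simple and connected, and $n$ denotes the number of nodes. The nodes of a graph $G=(V,E)$ carry pairwise distinct identifiers $\mathsf{id}(u)\in\mathbb N$ of $O(\log n)$ bits. A verification algorithm with locality $1$ is a function $\mathcal A$ with values in $\{\mathsf{Accept},\mathsf{Reject}\}$; given a certificate function $c$, which assigns a bit string $c(u)$ to every node $u$, the output of $u$ is the value of $\mathcal A$ on $(\mathsf{id}(u),c(u))$ and the set $\{(\mathsf{id}(v),c(v)) : v \text{ a neighbor of } u\}$. A graph is $P_5$-free if it does not contain the path on $5$ nodes as an induced subgraph. **Theorem.** There is a proof-labeling scheme with locality $1$ that certifies $P_5$-freeness with certificates of size $O(n\log n)$. That is, there is a verification algorithm $\mathcal A$ with locality $1$ such that for every function $b:\mathbb N\to\mathbb N$ with $b(n)=O(\log n)$ there is a function $s:\mathbb N\to\mathbb N$ with $s(n)=O(n\log n)$ such that the following holds for every connected graph $G$ on $n$ nodes and every assignment of pairwise distinct identifiers of at most $b(n)$ bits to its nodes: - if $G$ is $P_5$-free, then there is a certificate function $c$ with $|c(u)|=s(n)$ for all nodes $u$ such that all nodes output $\mathsf{Accept}$; - if $G$ is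 not $P_5$-free, then for every certificate function $c$ at least one node outputs $\mathsf{Reject}$. -/

import Mathlib

open Filter Asymptotics

namespace LocalCert

/-- A verification algorithm: given the identifier and the certificate of a node, and the set of
pairs (identifier, certificate) of the other nodes that it sees, it outputs accept (`true`) or
reject (`false`). -/
abbrev Verifier : Type := ℕ → List Bool → Finset (ℕ × List Bool) → Bool

/-- The pairs (identifier, certificate) of the `ℓ`-hop neighbors of `u`, i.e. of the nodes
`v ≠ u` at distance at most `ℓ` from `u` (nodes that are not reachable from `u` have
`G.dist u v = 0`, and so does `u` itself). -/
noncomputable def view {V : Type} [Fintype V] (ℓ : ℕ) (G : SimpleGraph V) (ident : V → ℕ)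
    (c : V → List Bool) (u : V) : Finset (ℕ × List Bool) := by
  classical
  exact (Finset.univ.filter fun v => 0 < G.dist u v ∧ G.dist u v ≤ ℓ).image
    fun v => (ident v, c v)

/-- The node `u` accepts when `A` is run with locality `ℓ`. -/
def Accepts {V : Type} [Fintype V] (A : Verifier) (ℓ : ℕ) (G : SimpleGraph V) (ident : V → ℕ)
    (c : V → List Bool) (u : V) : Prop :=
  A (ident u) (c u) (view ℓ G ident c u) = true

/-- The verifier `A` with locality `ℓ` certifies the property `P` on connected graphs, with
certificates of `s n` bits, when the `n` nodes have distinct identifiers of at most `b n` bits: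
if `G` satisfies `P`, some assignment of certificates of `s n` bits makes all nodes accept; if `G`
does not satisfy `P`, every assignment of certificates (of whatever lengths) makes some node
reject. -/
def Certifies (A : Verifier) (ℓ : ℕ) (P : ∀ {V : Type}, SimpleGraph V → Prop)
    (b s : ℕ → ℕ) : Prop :=
  ∀ (V : Type) [Fintype V] (G : SimpleGraph V) (ident : V → ℕ),
    G.Connected → Function.Injective ident →
    (∀ u, (ident u).size ≤ b (Fintype.card V)) →
      (P G → ∃ c : V → List Bool, (∀ u, (c u).length = s (Fintype.card V)) ∧
        ∀ u, Accepts A ℓ G ident c u) ∧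
      (¬ P G → ∀ c : V → List Bool, ∃ u, ¬ Accepts A ℓ G ident c u)

/-- `G` has no induced path on `k` nodes. -/
def PathFree (k : ℕ) {V : Type} (G : SimpleGraph V) : Prop :=
  ¬ (SimpleGraph.pathGraph k).IsIndContained G

/-- There is a proof-labeling scheme with locality `ℓ` that certifies `P` with certificates of
size `O(f n)`: there is one verifier that works for all graphs and all identifiers, and whenever
the identifiers have `O(log n)` bits, certificates of `O(f n)` bits suffice. -/
def HasPLS (ℓ : ℕ) (P : ∀ {V : Type}, SimpleGraph V → Prop) (f : ℕ → ℝ) : Prop :=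
  ∃ A : Verifier, ∀ b : ℕ → ℕ, (fun n => (b n : ℝ)) =O[atTop] (fun n : ℕ => Real.log n) →
    ∃ s : ℕ → ℕ, (fun n => (s n : ℝ)) =O[atTop] f ∧ Certifies A ℓ P b s

end LocalCert

/-! Deciding `P₅`-freeness reduces to checking that a sum of locally computable integers is zero. An
induced path `a, b, c, d, e` is an almost path, where the pair `a, d` is left free, with `a` and `d`
not adjacent. So the number of induced paths is the number of almost paths minus the number of those
with `a` adjacent to `d`.

The first number is charged to `b`, which knows the neighborhoods of its neighbors `a` and `c`. It
need not see `d`: the number of `d` adjacent to `c` and `e` but not to `b` is the codegree of `c`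
and `e`, listed by `c`, minus the number of neighbors of `b` adjacent to both. The second number is
charged to `d`, which has `a`, `c` and `e` as neighbors and finds `b` in their lists
(`localCount_eq`). Neighbor lists and codegrees are themselves checkable with locality 1.

That the charges sum to zero is certified by a flow: each node forwards its charge plus what it
receives to one neighbor. Summing the conservation equations cancels all flow (`pathFree_of_check`);
conversely, a flow towards a root exists when the sum is zero (`exists_flow`). A label consists of
`O(n)` numbers of `O(log n)` bits. -/

namespace LocalCert

/-- The content of a certificate: the identifiers of the neighbors, the number of common neighbors
with every node, a pointer to a neighbor, and the amount of flow sent along the pointer. -/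
structure Label where
  nbrs : Finset ℕ
  codeg : ℕ → ℕ
  parent : ℕ
  flow : ℤ

open Classical in
/-- The contribution of a node with label `L`, whose neighbors have the identifiers and labels in
`S`, to the number of induced paths on five nodes. -/
noncomputable def localCount (L : Label) (S : Finset (ℕ × Label)) : ℤ :=
  (∑ a ∈ S, ∑ c ∈ S, ∑ᶠ e : ℕ,
    if a.1 ∉ c.2.nbrs ∧ e ∉ c.2.nbrs ∧ e ∉ L.nbrs ∧ e ∉ a.2.nbrs then
      (c.2.codeg e : ℤ) - ∑ d ∈ S, if d.1 ∈ c.2.nbrs ∧ e ∈ d.2.nbrs then 1 else 0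
    else 0) -
  ∑ a ∈ S, ∑ c ∈ S, ∑ e ∈ S, ∑ b ∈ a.2.nbrs,
    if a.1 ∉ c.2.nbrs ∧ b ∈ c.2.nbrs ∧ b ∉ L.nbrs ∧ e.1 ∉ c.2.nbrs ∧ b ∉ e.2.nbrs ∧
      e.1 ∉ a.2.nbrs then 1 else 0

open Classical in
/-- The conditions that a node with identifier `i` and label `L` checks, when its neighbors have
the identifiers and labels in `S`. -/
structure Check (i : ℕ) (L : Label) (S : Finset (ℕ × Label)) : Prop where
  nbrs_eq : L.nbrs = S.image Prod.fst
  codeg_eq : ∀ x, L.codeg x = (S.filter fun w => x ∈ w.2.nbrs).card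
  parent_mem : L.flow = 0 ∨ L.parent ∈ L.nbrs
  flow_eq : L.flow = localCount L S + ∑ w ∈ S, if w.2.parent = i then w.2.flow else 0

/-! ### Counting induced paths on five nodes -/

/-- `a, b, c, d, e` is an induced path, except that `a` and `d` may be adjacent. -/
def AlmostPath {V : Type} (G : SimpleGraph V) (a b c d e : V) : Prop :=
  (G.Adj b a ∧ G.Adj b c ∧ G.Adj c d ∧ G.Adj d e) ∧
    ¬ G.Adj c a ∧ ¬ G.Adj c e ∧ ¬ G.Adj b e ∧ ¬ G.Adj a e ∧ ¬ G.Adj b d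

open Classical in
/-- The contribution of `v` to the number of induced paths on five nodes. -/
noncomputable def pathCountAt {V : Type} [Fintype V] (G : SimpleGraph V) (v : V) : ℤ :=
  (∑ a, ∑ c, ∑ e, ∑ d, if AlmostPath G a v c d e then 1 else 0) -
    ∑ a, ∑ c, ∑ e, ∑ b, if AlmostPath G a b c v e ∧ G.Adj v a then 1 else 0

-- The two parts of `pathCountAt` charge almost paths to their second and to their fourth node.
-- After summation over all nodes the order of summation can be changed, and the parts are
-- subtracted term by term.
open Classical in
theorem sum_pathCountAt {V : Type} [Fintype V] (G : SimpleGraph V) :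
    ∑ v, pathCountAt G v =
      ∑ b, ∑ a, ∑ c, ∑ e, ∑ d, if AlmostPath G a b c d e ∧ ¬ G.Adj d a then (1 : ℤ) else 0 := by
  have hcomm : ∀ g : V → V → V → V → V → ℤ,
      ∑ d, ∑ a, ∑ c, ∑ e, ∑ b, g a b c d e = ∑ b, ∑ a, ∑ c, ∑ e, ∑ d, g a b c d e := by
    intro g
    calc ∑ d, ∑ a, ∑ c, ∑ e, ∑ b, g a b c d e
        = ∑ d, ∑ b, ∑ a, ∑ c, ∑ e, g a b c d e := by
          refine Finset.sum_congr rfl fun d _ => ?_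
          rw [Finset.sum_comm]
          refine Eq.trans ?_ Finset.sum_comm
          rw [Finset.sum_comm]
          refine Finset.sum_congr rfl fun a _ => ?_
          refine Eq.trans ?_ Finset.sum_comm
          refine Finset.sum_congr rfl fun c _ => Finset.sum_comm
      _ = ∑ b, ∑ d, ∑ a, ∑ c, ∑ e, g a b c d e := Finset.sum_comm
      _ = _ := by
          refine Finset.sum_congr rfl fun b _ => ?_
          rw [Finset.sum_comm]
          refine Finset.sum_congr rfl fun a _ => ?_
          rw [Finset.sum_comm]
          refine Finset.sum_congr rfl fun c _ => ?_
          rw [Finset.sum_comm]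
  unfold pathCountAt
  rw [Finset.sum_sub_distrib,
    hcomm (fun a b c d e => if AlmostPath G a b c d e ∧ G.Adj d a then (1 : ℤ) else 0)]
  simp only [← Finset.sum_sub_distrib]
  refine Finset.sum_congr rfl fun b _ => Finset.sum_congr rfl fun a _ =>
    Finset.sum_congr rfl fun c _ => Finset.sum_congr rfl fun e _ =>
    Finset.sum_congr rfl fun d _ => ?_
  by_cases h1 : AlmostPath G a b c d e <;> by_cases h2 : G.Adj d a <;> simp [h1, h2]

theorem isIndContained_of_almostPath {V : Type} {G : SimpleGraph V} {a b c d e : V}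
    (h : AlmostPath G a b c d e) (had : ¬ G.Adj d a) :
    (SimpleGraph.pathGraph 5).IsIndContained G := by
  obtain ⟨⟨hba, hbc, hcd, hde⟩, hca, hce, hbe, hae, hbd⟩ := h
  have hadj : ∀ i j : Fin 5, G.Adj (![a, b, c, d, e] i) (![a, b, c, d, e] j) ↔
      (SimpleGraph.pathGraph 5).Adj i j := by
    intro i j
    rw [SimpleGraph.pathGraph_adj]
    fin_cases i <;> fin_cases j <;>
      simp [hba, hbc, hcd, hde, hca, hce, hbe, hae, hbd, had, hba.symm, hbc.symm, hcd.symm,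
        hde.symm, G.adj_comm a c, G.adj_comm e c, G.adj_comm e b, G.adj_comm e a, G.adj_comm d b,
        G.adj_comm a d]
  -- Distinctness is automatic: distinct nodes of the path on five nodes have distinct
  -- neighborhoods.
  have hinj : Function.Injective ![a, b, c, d, e] := by
    intro i j hij
    have key : ∀ k, (SimpleGraph.pathGraph 5).Adj i k ↔ (SimpleGraph.pathGraph 5).Adj j k :=
      fun k => by rw [← hadj, ← hadj, hij]
    simp only [SimpleGraph.pathGraph_adj] at key
    revert key
    clear hij
    revert i j
    decide
  exact ⟨⟨⟨_, hinj⟩, hadj _ _⟩⟩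

theorem pathFree_five_iff {V : Type} [Fintype V] (G : SimpleGraph V) :
    PathFree 5 G ↔ ∑ v, pathCountAt G v = 0 := by
  classical
  rw [sum_pathCountAt]
  constructor
  · intro h
    refine Finset.sum_eq_zero fun b _ => Finset.sum_eq_zero fun a _ =>
      Finset.sum_eq_zero fun c _ => Finset.sum_eq_zero fun e _ =>
      Finset.sum_eq_zero fun d _ => if_neg fun hp => h ?_
    exact isIndContained_of_almostPath hp.1 hp.2
  · rintro h ⟨φ⟩
    have key : ∀ i j : Fin 5, G.Adj (φ i) (φ j) ↔ (i.val + 1 = j.val ∨ j.val + 1 = i.val) :=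
      fun i j => by rw [φ.map_rel_iff, SimpleGraph.pathGraph_adj]
    have h1 : AlmostPath G (φ 0) (φ 1) (φ 2) (φ 3) (φ 4) ∧ ¬ G.Adj (φ 3) (φ 0) := by
      simp only [AlmostPath, key]
      decide
    have nn : ∀ a b c d e : V,
        (0 : ℤ) ≤ if AlmostPath G a b c d e ∧ ¬ G.Adj d a then (1 : ℤ) else 0 := by
      intros; split_ifs <;> norm_num
    -- Single charges may be negative, but the rearranged total has nonnegative terms, so each term
    -- vanishes; the five sums are peeled off in turn.
    have h2 := (Finset.sum_eq_zero_iff_of_nonneg (fun b _ => Finset.sum_nonneg fun a _ =>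
      Finset.sum_nonneg fun c _ => Finset.sum_nonneg fun e _ => Finset.sum_nonneg fun d _ =>
        nn a b c d e)).1 h (φ 1) (Finset.mem_univ _)
    have h3 := (Finset.sum_eq_zero_iff_of_nonneg (fun a _ =>
      Finset.sum_nonneg fun c _ => Finset.sum_nonneg fun e _ => Finset.sum_nonneg fun d _ =>
        nn a (φ 1) c d e)).1 h2 (φ 0) (Finset.mem_univ _)
    have h4 := (Finset.sum_eq_zero_iff_of_nonneg (fun c _ =>
      Finset.sum_nonneg fun e _ => Finset.sum_nonneg fun d _ =>
        nn (φ 0) (φ 1) c d e)).1 h3 (φ 2) (Finset.mem_univ _)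
    have h5 := (Finset.sum_eq_zero_iff_of_nonneg (fun e _ => Finset.sum_nonneg fun d _ =>
        nn (φ 0) (φ 1) (φ 2) d e)).1 h4 (φ 4) (Finset.mem_univ _)
    have h6 := (Finset.sum_eq_zero_iff_of_nonneg (fun d _ =>
        nn (φ 0) (φ 1) (φ 2) d (φ 4))).1 h5 (φ 3) (Finset.mem_univ _)
    rw [if_pos h1] at h6
    exact one_ne_zero h6

theorem abs_pathCountAt_le {V : Type} [Fintype V] (G : SimpleGraph V) (v : V) :
    |pathCountAt G v| ≤ 2 * (Fintype.card V : ℤ) ^ 4 := by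
  classical
  have key : ∀ (p : V → V → V → V → Prop) [∀ a c e d, Decidable (p a c e d)],
      |∑ a, ∑ c, ∑ e, ∑ d, if p a c e d then (1 : ℤ) else 0| ≤ (Fintype.card V : ℤ) ^ 4 := by
    intro p _
    have hb : ∀ (g : V → ℤ) (B : ℤ), (∀ x, |g x| ≤ B) → |∑ x, g x| ≤ Fintype.card V * B := by
      intro g B h
      refine (Finset.abs_sum_le_sum_abs _ _).trans ?_
      refine (Finset.sum_le_card_nsmul _ _ B fun x _ => h x).trans ?_
      simp
    have : (Fintype.card V : ℤ) ^ 4 = Fintype.card V * (Fintype.card V * (Fintype.card V *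
      (Fintype.card V * 1))) := by ring
    rw [this]
    refine hb _ _ fun a => hb _ _ fun c => hb _ _ fun e => hb _ _ fun d => ?_
    split_ifs <;> simp
  unfold pathCountAt
  refine (abs_sub _ _).trans ?_
  have h1 := key fun a c e d => AlmostPath G a v c d e
  have h2 := key fun a c e b => AlmostPath G a b c v e ∧ G.Adj v a
  linarith

/-! ### Soundness: correct labels and conserved flow -/

open Classical in
/-- The identifiers and labels of the neighbors of `v`. -/
noncomputable def nbrLabels {V : Type} [Fintype V] (G : SimpleGraph V) (ident : V → ℕ)
    (lab : V → Label) (v : V) : Finset (ℕ × Label) :=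
  (Finset.univ.filter fun w => G.Adj v w).image fun w => (ident w, lab w)

section

variable {V : Type} [Fintype V] {G : SimpleGraph V} {ident : V → ℕ} {lab : V → Label}

open Classical in
theorem sum_nbrLabels (hinj : Function.Injective ident) (v : V) (g : ℕ × Label → ℤ) :
    ∑ w ∈ nbrLabels G ident lab v, g w = ∑ w, if G.Adj v w then g (ident w, lab w) else 0 := by
  unfold nbrLabels
  rw [Finset.sum_image fun x _ y _ h => hinj (Prod.ext_iff.1 h).1, Finset.sum_filter]

theorem image_fst_nbrLabels (v : V) (x : ℕ) [DecidableEq ℕ] :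
    x ∈ (nbrLabels G ident lab v).image Prod.fst ↔ ∃ w, G.Adj v w ∧ ident w = x := by
  simp [nbrLabels]

theorem card_filter_nbrLabels (hinj : Function.Injective ident) (v : V)
    (p : ℕ × Label → Prop) [DecidablePred p] [DecidableRel G.Adj] :
    (((nbrLabels G ident lab v).filter p).card : ℤ) =
      ∑ w, if G.Adj v w ∧ p (ident w, lab w) then 1 else 0 := by
  rw [Finset.card_filter]
  push_cast
  rw [sum_nbrLabels hinj]
  refine Finset.sum_congr rfl fun w _ => ?_
  by_cases h : G.Adj v w <;> simp [h]

open Classical in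
/-- With correct neighbor lists and codegrees, the local count is the contribution of the node to
the number of induced paths. -/
theorem localCount_eq (hinj : Function.Injective ident)
    (hn : ∀ v x, x ∈ (lab v).nbrs ↔ ∃ w, G.Adj v w ∧ ident w = x)
    (hc : ∀ v x, (lab v).codeg x =
      ((nbrLabels G ident lab v).filter fun w => x ∈ w.2.nbrs).card) (v : V) :
    localCount (lab v) (nbrLabels G ident lab v) = pathCountAt G v := by
  have hadj : ∀ u w, ident w ∈ (lab u).nbrs ↔ G.Adj u w := by
    intro u w
    rw [hn]
    exact ⟨fun ⟨w', h, h'⟩ => hinj h' ▸ h, fun h => ⟨w, h, rfl⟩⟩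
  have hcod : ∀ (u : V) (x : ℕ), ((lab u).codeg x : ℤ) =
      ∑ d, if G.Adj u d ∧ x ∈ (lab d).nbrs then 1 else 0 := by
    intro u x
    rw [hc, card_filter_nbrLabels hinj]
  unfold localCount pathCountAt
  congr 1
  · rw [sum_nbrLabels hinj]
    refine Finset.sum_congr rfl fun a _ => ?_
    by_cases hva : G.Adj v a
    swap
    · rw [if_neg hva]
      simp [AlmostPath, hva]
    rw [if_pos hva, sum_nbrLabels hinj]
    refine Finset.sum_congr rfl fun c _ => ?_
    by_cases hvc : G.Adj v c
    swap
    · rw [if_neg hvc]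
      simp [AlmostPath, hvc]
    rw [if_pos hvc]
    simp only [sum_nbrLabels hinj, hcod]
    -- A number that is no identifier lies in no neighbor list, so its codegrees and its summand
    -- vanish and the sum over all naturals is a sum over nodes.
    rw [finsum_eq_sum_of_support_subset (s := Finset.univ.image ident),
      Finset.sum_image fun x _ y _ h => hinj h]
    · refine Finset.sum_congr rfl fun e _ => ?_
      simp only [hadj, ← Finset.sum_sub_distrib]
      by_cases hcond : ¬ G.Adj c a ∧ ¬ G.Adj c e ∧ ¬ G.Adj v e ∧ ¬ G.Adj a e
      · rw [if_pos hcond]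
        refine Finset.sum_congr rfl fun d _ => ?_
        by_cases h1 : G.Adj c d <;> by_cases h2 : G.Adj d e <;> by_cases h3 : G.Adj v d <;>
          simp [AlmostPath, hva, hvc, h1, h2, h3, hcond]
      · rw [if_neg hcond]
        refine (Finset.sum_eq_zero fun d _ => if_neg fun h => hcond ?_).symm
        exact ⟨h.2.1, h.2.2.1, h.2.2.2.1, h.2.2.2.2.1⟩
    · intro x hx
      by_contra hx'
      refine hx ?_
      have hno : ∀ d, x ∉ (lab d).nbrs := by
        intro d hd
        obtain ⟨w, -, rfl⟩ := (hn d x).1 hd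
        exact hx' (by simp)
      simp [hno]
  · rw [sum_nbrLabels hinj]
    refine Finset.sum_congr rfl fun a _ => ?_
    by_cases hva : G.Adj v a
    swap
    · simp [hva]
    rw [if_pos hva, sum_nbrLabels hinj]
    refine Finset.sum_congr rfl fun c _ => ?_
    by_cases hvc : G.Adj v c
    swap
    · rw [if_neg hvc]
      simp [AlmostPath, G.adj_comm c v, hvc]
    rw [if_pos hvc, sum_nbrLabels hinj]
    refine Finset.sum_congr rfl fun e _ => ?_
    by_cases hve : G.Adj v e
    swap
    · rw [if_neg hve]
      simp [AlmostPath, hve]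
    rw [if_pos hve]
    have hset : (lab a).nbrs = (Finset.univ.filter fun w => G.Adj a w).image ident := by
      ext x
      simp [hn]
    simp only [hadj]
    rw [hset, Finset.sum_image fun x _ y _ h => hinj h, Finset.sum_filter]
    refine Finset.sum_congr rfl fun b _ => ?_
    simp only [hadj]
    rw [← ite_and]
    refine if_congr ?_ rfl rfl
    simp only [AlmostPath, G.adj_comm b a, G.adj_comm b c, G.adj_comm b v, G.adj_comm b e,
      G.adj_comm c v]
    tauto

/-- Nodes that all accept witness that there is no induced path on five nodes. -/
theorem pathFree_of_check (hinj : Function.Injective ident)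
    (h : ∀ v, Check (ident v) (lab v) (nbrLabels G ident lab v)) : PathFree 5 G := by
  classical
  have hn : ∀ v x, x ∈ (lab v).nbrs ↔ ∃ w, G.Adj v w ∧ ident w = x := fun v x => by
    rw [(h v).nbrs_eq, image_fst_nbrLabels]
  have hc := fun v => (h v).codeg_eq
  rw [pathFree_five_iff]
  have hflow : ∀ v, (lab v).flow = pathCountAt G v +
      ∑ w, if G.Adj v w ∧ (lab w).parent = ident v then (lab w).flow else 0 := by
    intro v
    rw [(h v).flow_eq, sum_nbrLabels hinj, localCount_eq hinj hn hc]
    simp only [ite_and]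
  have hpush : ∀ w, ∑ v, (if G.Adj v w ∧ (lab w).parent = ident v then (lab w).flow else 0) =
      (lab w).flow := by
    intro w
    rcases (h w).parent_mem with h0 | hp
    · simp [h0]
    · obtain ⟨u, hu, hu'⟩ := (hn w _).1 hp
      rw [Finset.sum_eq_single u]
      · rw [if_pos ⟨hu.symm, hu'.symm⟩]
      · exact fun v _ hv => if_neg fun h' => hv (hinj (hu'.trans h'.2)).symm
      · simp
  -- Each flow is received exactly once, so the flows cancel. The pointers need not form a tree:
  -- cycles do no harm.
  have hsum : ∑ v, (lab v).flow = ∑ v, pathCountAt G v + ∑ v, (lab v).flow := by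
    calc ∑ v, (lab v).flow = ∑ v, (pathCountAt G v +
          ∑ w, if G.Adj v w ∧ (lab w).parent = ident v then (lab w).flow else 0) :=
          Finset.sum_congr rfl fun v _ => hflow v
      _ = _ := by
          rw [Finset.sum_add_distrib, Finset.sum_comm]
          congr 1
          exact Finset.sum_congr rfl fun w _ => hpush w
  linarith

end

/-! ### Routing charges to a root -/

/-- Every connected graph carries pointers to a root, along which any vector of sum zero can be
transported by a flow of bounded size. -/
theorem exists_flow {V : Type} [Fintype V] {G : SimpleGraph V} (hG : G.Connected) (f : V → ℤ)
    (hf : ∑ v, f v = 0) (B : ℤ) (hB : ∀ v, |f v| ≤ B) [DecidableEq V] [DecidableRel G.Adj] :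
    ∃ (p : V → V) (σ : V → ℤ), (∀ v, σ v = 0 ∨ G.Adj v (p v)) ∧
      (∀ v, σ v = f v + ∑ w, if G.Adj v w ∧ p w = v then σ w else 0) ∧
      ∀ v, |σ v| ≤ Fintype.card V * B := by
  obtain ⟨r⟩ := hG.nonempty
  have hpar : ∀ v, ∃ u, (v = r → u = r) ∧ (v ≠ r → G.Adj v u ∧ G.dist u r < G.dist v r) := by
    intro v
    by_cases hv : v = r
    · exact ⟨r, fun _ => rfl, fun h => (h hv).elim⟩
    · obtain ⟨q, hq⟩ := (hG.preconnected v r).exists_walk_length_eq_dist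
      cases q with
      | nil => exact (hv rfl).elim
      | cons hadj q' =>
        refine ⟨_, fun h => (hv h).elim, fun _ => ⟨hadj, ?_⟩⟩
        have := SimpleGraph.dist_le q'
        rw [SimpleGraph.Walk.length_cons] at hq
        omega
  choose p hpr hp using hpar
  -- `g` is the indicator of the pointer path from `u` to `r`. Its vanishing beyond distance `k`
  -- keeps `u` off the path of `p u`, so that prepending `u` preserves the bound 1.
  have hroute : ∀ k u, G.dist u r = k → ∃ g : V → ℤ,
      (∀ v, g v = (if v = u then 1 else 0) + ∑ w, if w ≠ r ∧ p w = v then g w else 0) ∧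
      (∀ v, 0 ≤ g v ∧ g v ≤ 1) ∧ (∀ v, k < G.dist v r → g v = 0) ∧ g r = 1 := by
    intro k
    induction k using Nat.strong_induction_on with
    | _ k ih =>
      intro u hu
      by_cases hur : u = r
      · subst hur
        refine ⟨fun v => if v = u then 1 else 0, fun v => ?_, fun v => ?_, fun v hv => ?_, ?_⟩
        · rw [Finset.sum_eq_zero, add_zero]
          intro w _
          by_cases hw : w = u <;> simp [hw]
        · dsimp only; split_ifs <;> norm_num
        · refine if_neg ?_
          rintro rfl
          omega
        · simp
      · obtain ⟨hadj, hlt⟩ := hp u hur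
        obtain ⟨g, hg, hg01, hg0, hgr⟩ := ih _ (hu ▸ hlt) (p u) rfl
        have hgu : g u = 0 := hg0 u hlt
        refine ⟨fun v => (if v = u then 1 else 0) + g v, fun v => ?_, fun v => ?_,
          fun v hv => ?_, ?_⟩
        · dsimp only
          rw [hg v]
          congr 1
          have hsplit : ∀ w, (if w ≠ r ∧ p w = v then (if w = u then 1 else 0) + g w else 0) =
              (if w = u then (if v = p u then (1 : ℤ) else 0) else 0) +
                if w ≠ r ∧ p w = v then g w else 0 := by
            intro w
            by_cases hw : w = u
            · subst hw
              by_cases hv : p w = v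
              · simp [hur, hv]
              · simp [hv, Ne.symm hv]
            · simp [hw]
          simp only [hsplit, Finset.sum_add_distrib, Finset.sum_ite_eq', Finset.mem_univ, if_true]
        · dsimp only
          by_cases hv : v = u
          · subst hv; simp [hgu]
          · simpa [hv] using hg01 v
        · dsimp only
          rw [hg0 v (by omega), if_neg, add_zero]
          rintro rfl
          omega
        · dsimp only
          rw [hgr, if_neg (Ne.symm hur), zero_add]
  choose g hg hg01 _ hgr using fun u => hroute _ u rfl
  -- All paths end at `r`, so the root would forward the total of `f`, which is zero; hence it needs
  -- no valid pointer.
  have hσr : ∑ u, f u * g u r = 0 := by simp [hgr, hf]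
  refine ⟨p, fun v => ∑ u, f u * g u v, fun v => ?_, fun v => ?_, fun v => ?_⟩
  · by_cases hv : v = r
    · left; subst hv; exact hσr
    · right; exact (hp v hv).1
  · have h1 : ∀ w, (if G.Adj v w ∧ p w = v then ∑ u, f u * g u w else 0) =
        if w ≠ r ∧ p w = v then ∑ u, f u * g u w else 0 := by
      intro w
      by_cases hw : w = r
      · subst hw; simp [hσr]
      · by_cases hwv : p w = v
        · have := (hp w hw).1.symm
          rw [hwv] at this
          simp [hw, hwv, this]
        · simp [hwv]
    simp only [h1]
    calc ∑ u, f u * g u v = ∑ u, (f u * (if v = u then 1 else 0) +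
          ∑ w, if w ≠ r ∧ p w = v then f u * g u w else 0) := by
          refine Finset.sum_congr rfl fun u _ => ?_
          rw [hg u v, mul_add, Finset.mul_sum]
          simp only [mul_ite, mul_zero]
      _ = _ := by
          rw [Finset.sum_add_distrib, Finset.sum_comm]
          congr 1
          · simp
          · refine Finset.sum_congr rfl fun w _ => ?_
            split_ifs <;> simp
  · refine (Finset.abs_sum_le_sum_abs _ _).trans ?_
    have hB0 : 0 ≤ B := (abs_nonneg _).trans (hB r)
    refine (Finset.sum_le_card_nsmul _ _ B fun u _ => ?_).trans ?_
    · rw [abs_mul, abs_of_nonneg (hg01 u v).1]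
      exact (mul_le_mul (hB u) (hg01 u v).2 (hg01 u v).1 hB0).trans (mul_one B).le
    · simp

/-! ### Encoding labels as bit strings -/

/-- Reads a list of natural numbers: a bit `b` of a number, least significant first, is written as
`true, b`, the end of a number as `false, true`, and anything else ends the list. -/
def decodeNats : List Bool → List ℕ
  | true :: b :: l =>
    match decodeNats l with
    | [] => []
    | x :: xs => Nat.bit b x :: xs
  | false :: true :: l => 0 :: decodeNats l
  | _ => []

theorem exists_code_nat (k : ℕ) : ∃ w : List Bool, w.length = 2 * k.size + 2 ∧
    ∀ l, decodeNats (w ++ l) = k :: decodeNats l := by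
  induction k using Nat.strong_induction_on with
  | _ k ih =>
    rcases Nat.eq_zero_or_pos k with rfl | hk
    · exact ⟨[false, true], by simp, fun l => by simp [decodeNats]⟩
    · obtain ⟨w, hw, hl⟩ := ih (k / 2) (by omega)
      have hbit : Nat.bit k.bodd k.div2 = k := Nat.bit_bodd_div2 k
      refine ⟨true :: k.bodd :: w, ?_, fun l => ?_⟩
      · have hsz : k.size = (k / 2).size + 1 := by
          rw [← Nat.div2_val]
          conv_lhs => rw [← hbit]
          exact Nat.size_bit (by rw [hbit]; omega)
        simp only [List.length_cons, hw, hsz]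
        ring
      · simp only [List.cons_append, decodeNats, hl, ← Nat.div2_val, hbit]

/-- Padding with `false` decodes to nothing, so all certificates can be given the same length. -/
theorem exists_code_nats (m : ℕ) (xs : List ℕ) (hxs : ∀ x ∈ xs, x.size ≤ m) (s : ℕ)
    (hs : (2 * m + 2) * xs.length ≤ s) :
    ∃ w : List Bool, w.length = s ∧ decodeNats w = xs := by
  induction xs generalizing s with
  | nil =>
    refine ⟨List.replicate s false, by simp, ?_⟩
    match s with
    | 0 => rfl
    | 1 => rfl
    | s + 2 => rfl
  | cons x xs ih =>
    obtain ⟨w, hw, hl⟩ := exists_code_nat x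
    have hx := hxs x (by simp)
    rw [List.length_cons, mul_add, mul_one] at hs
    obtain ⟨w', hw', hl'⟩ := ih (fun y hy => hxs y (by simp [hy])) (s - w.length) (by omega)
    exact ⟨w ++ w', by rw [List.length_append, hw']; omega, by rw [hl, hl']⟩

/-- Groups a list into consecutive pairs. -/
def pairUp : List ℕ → List (ℕ × ℕ)
  | x :: y :: l => (x, y) :: pairUp l
  | _ => []

theorem pairUp_flatMap (l : List (ℕ × ℕ)) : pairUp (l.flatMap fun r => [r.1, r.2]) = l := by
  induction l with
  | nil => rfl
  | cons r l ih => simp [pairUp, ih]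

/-- Reads a label: the pointer, the positive and the negative part of the flow, and then pairs that
consist of an identifier and of twice the codegree, plus one for neighbors. -/
def labelOfNats : List ℕ → Label
  | p :: s :: t :: l =>
    { nbrs := (((pairUp l).filter fun r => r.2 % 2 = 1).map Prod.fst).toFinset
      codeg := fun x => ((pairUp l).map fun r => if r.1 = x then r.2 / 2 else 0).sum
      parent := p
      flow := (s : ℤ) - t }
  | _ => ⟨∅, fun _ => 0, 0, 0⟩

/-- The label that a certificate stands for. -/
def labelOfBits (l : List Bool) : Label := labelOfNats (decodeNats l)

/-! ### The verifier and its completeness -/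

open Classical in
/-- The verifier for graphs without induced paths on five nodes. -/
noncomputable def pathVerifier : Verifier := fun i c S =>
  decide (Check i (labelOfBits c) (S.image fun w => (w.1, labelOfBits w.2)))

theorem accepts_pathVerifier_iff {V : Type} [Fintype V] (G : SimpleGraph V) (ident : V → ℕ)
    (c : V → List Bool) (u : V) : Accepts pathVerifier 1 G ident c u ↔
      Check (ident u) (labelOfBits (c u)) (nbrLabels G ident (fun v => labelOfBits (c v)) u) := by
  classical
  have h : ∀ v, 0 < G.dist u v ∧ G.dist u v ≤ 1 ↔ G.Adj u v := fun v => by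
    rw [← SimpleGraph.dist_eq_one_iff_adj]
    omega
  have hS : (view 1 G ident c u).image (fun w => (w.1, labelOfBits w.2)) =
      nbrLabels G ident (fun v => labelOfBits (c v)) u := by
    ext x
    simp [view, nbrLabels, h]
  unfold Accepts pathVerifier
  rw [decide_eq_true_iff]
  convert Iff.rfl using 2
  rw [← hS]

/-- Neighbor lists, codegrees, pointers and flows can be written into certificates. -/
theorem exists_certificate {V : Type} [Fintype V] (G : SimpleGraph V) [DecidableRel G.Adj]
    (ident : V → ℕ) (v : V) (t : V → ℕ) (p : ℕ) (σ : ℤ)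
    (m s : ℕ) (hm : ∀ u, (ident u).size ≤ m) (hp : p.size ≤ m)
    (ht : ∀ u, (2 * t u + 1).size ≤ m) (hσ : σ.natAbs.size ≤ m)
    (hs : (2 * m + 2) * (2 * Fintype.card V + 3) ≤ s) :
    ∃ w : List Bool, w.length = s ∧
      (∀ x, x ∈ (labelOfBits w).nbrs ↔ ∃ u, G.Adj v u ∧ ident u = x) ∧
      (∀ x, (labelOfBits w).codeg x = ∑ u, if ident u = x then t u else 0) ∧
      (labelOfBits w).parent = p ∧ (labelOfBits w).flow = σ := by
  classical
  let rows : List (ℕ × ℕ) := Finset.univ.toList.map fun u =>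
    (ident u, 2 * t u + if G.Adj v u then 1 else 0)
  let xs : List ℕ := p :: σ.toNat :: (-σ).toNat :: rows.flatMap fun r => [r.1, r.2]
  have hlen : xs.length = 2 * Fintype.card V + 3 := by
    simp [xs, rows, List.length_flatMap, mul_comm]
  have hxs : ∀ x ∈ xs, x.size ≤ m := by
    intro x hx
    simp only [xs, rows, List.mem_cons, List.mem_flatMap, List.mem_map, Finset.mem_toList,
      Finset.mem_univ, true_and, List.not_mem_nil, or_false] at hx
    rcases hx with rfl | rfl | rfl | ⟨r, ⟨u, rfl⟩, rfl | rfl⟩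
    · exact hp
    · exact (Nat.size_le_size (by omega)).trans hσ
    · exact (Nat.size_le_size (by omega)).trans hσ
    · exact hm u
    · refine (Nat.size_le_size ?_).trans (ht u)
      dsimp only
      split_ifs <;> omega
  obtain ⟨w, hw, hdec⟩ := exists_code_nats m xs hxs s (hlen ▸ hs)
  refine ⟨w, hw, fun x => ?_, fun x => ?_, ?_, ?_⟩
  · simp only [labelOfBits, hdec, xs, labelOfNats, pairUp_flatMap, rows]
    simp only [List.mem_toFinset, List.mem_map, List.mem_filter, Finset.mem_toList,
      Finset.mem_univ, true_and, decide_eq_true_iff]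
    constructor
    · rintro ⟨r, ⟨⟨u, rfl⟩, hr⟩, rfl⟩
      refine ⟨u, ?_, rfl⟩
      by_contra hadj
      simp [hadj] at hr
    · rintro ⟨u, hadj, rfl⟩
      exact ⟨_, ⟨⟨u, rfl⟩, by simp [hadj, Nat.add_mod]⟩, rfl⟩
  · simp only [labelOfBits, hdec, xs, labelOfNats, pairUp_flatMap, rows, List.map_map]
    rw [← Finset.sum_map_toList]
    congr 1
    refine List.map_congr_left fun u _ => ?_
    simp only [Function.comp]
    congr 1
    split_ifs <;> omega
  · simp [labelOfBits, hdec, xs, labelOfNats]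
  · simp only [labelOfBits, hdec, xs, labelOfNats]
    omega

/-- In a graph without induced paths on five nodes, some certificates make all nodes accept. -/
theorem exists_accepting_certificates {V : Type} [Fintype V] {G : SimpleGraph V} {ident : V → ℕ}
    (hG : G.Connected) (hinj : Function.Injective ident) (k : ℕ)
    (hk : ∀ u, (ident u).size ≤ k) (hfree : PathFree 5 G) :
    ∃ c : V → List Bool,
      (∀ u, (c u).length =
        (2 * (k + 5 * (Fintype.card V).size + 2) + 2) * (2 * Fintype.card V + 3)) ∧
      ∀ u, Accepts pathVerifier 1 G ident c u := by
  classical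
  obtain ⟨p, σ, hp, hσ, hσB⟩ := exists_flow hG (pathCountAt G) ((pathFree_five_iff G).1 hfree) _
    (abs_pathCountAt_le G)
  set n := Fintype.card V with hn
  have hlt : n < 2 ^ n.size := Nat.lt_size_self n
  let t : V → V → ℕ := fun v u => (Finset.univ.filter fun w => G.Adj v w ∧ G.Adj w u).card
  have ht : ∀ v u, (2 * t v u + 1).size ≤ k + 5 * n.size + 2 := by
    intro v u
    have h1 : t v u ≤ n := Finset.card_le_univ _
    have h2 : (2 * t v u + 1).size ≤ n.size + 1 := by
      rw [Nat.size_le, pow_succ]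
      omega
    omega
  have hsz : ∀ v, (σ v).natAbs.size ≤ k + 5 * n.size + 2 := by
    intro v
    have h1 : (σ v).natAbs ≤ 2 * n ^ 5 := by
      have := hσB v
      zify
      calc |σ v| ≤ n * (2 * (n : ℤ) ^ 4) := this
        _ = 2 * (n : ℤ) ^ 5 := by ring
    have h2 : (σ v).natAbs.size ≤ 5 * n.size + 1 := by
      rw [Nat.size_le]
      calc (σ v).natAbs ≤ 2 * n ^ 5 := h1
        _ < 2 * (2 ^ n.size) ^ 5 := by
            have := Nat.pow_lt_pow_left hlt (by norm_num : 5 ≠ 0)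
            omega
        _ = 2 ^ (5 * n.size + 1) := by rw [← pow_mul, pow_succ]; ring_nf
    omega
  -- One width fits all entries: identifiers have at most `k` bits, codegree entries `n.size + 1`,
  -- flows `5 * n.size + 1`. There are `2 * n + 3` entries: a pair per node, the pointer and two
  -- parts of the flow.
  choose c hlen hnb hcod hpar hfl using fun v => exists_certificate G ident v (t v) (ident (p v))
    (σ v) (k + 5 * n.size + 2) _ (fun u => (hk u).trans (by omega)) ((hk _).trans (by omega))
    (ht v) (hsz v) le_rfl
  refine ⟨c, hlen, fun u => (accepts_pathVerifier_iff G ident c u).2 ?_⟩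
  have hadj : ∀ u w, ident w ∈ (labelOfBits (c u)).nbrs ↔ G.Adj u w := by
    intro u w
    rw [hnb]
    exact ⟨fun ⟨w', h, h'⟩ => hinj h' ▸ h, fun h => ⟨w, h, rfl⟩⟩
  have hcodeg : ∀ v x, (labelOfBits (c v)).codeg x =
      ((nbrLabels G ident (fun v => labelOfBits (c v)) v).filter
        fun w => x ∈ w.2.nbrs).card := by
    intro v x
    zify
    rw [card_filter_nbrLabels hinj, hcod]
    by_cases hx : ∃ u, ident u = x
    · obtain ⟨u, rfl⟩ := hx
      simp [hinj.eq_iff, hadj, t]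
    · rw [Finset.sum_eq_zero fun u _ => if_neg fun h => hx ⟨u, h⟩, Nat.cast_zero,
        Finset.sum_eq_zero]
      refine fun w _ => if_neg fun h => hx ?_
      obtain ⟨u, -, hu⟩ := (hnb w x).1 h.2
      exact ⟨u, hu⟩
  refine ⟨?_, hcodeg u, ?_, ?_⟩
  · ext x
    rw [hnb, image_fst_nbrLabels]
  · rw [hfl, hpar, hadj]
    exact hp u
  · rw [localCount_eq hinj hnb hcodeg, sum_nbrLabels hinj, hfl, hσ u]
    simp only [hpar, hfl, hinj.eq_iff, ite_and]

/-! ### Asymptotics of the certificate length -/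

theorem isBigO_size : (fun n : ℕ => (n.size : ℝ)) =O[atTop] fun n : ℕ => Real.log n := by
  -- From `2 ^ (n.size - 1) ≤ n` it follows that `n.size * log 2 ≤ log n + log 2 ≤ 2 * log n` for `n
  -- ≥ 2`.
  refine IsBigO.of_bound (2 / Real.log 2) ?_
  filter_upwards [eventually_ge_atTop 2] with n hn
  have h2 : 0 < Real.log 2 := Real.log_pos one_lt_two
  have hn' : (2 : ℝ) ≤ n := by exact_mod_cast hn
  have hlog : Real.log 2 ≤ Real.log n := Real.log_le_log two_pos hn'
  have hpos : 0 < n.size := Nat.size_pos.2 (by omega)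
  have hpow : 2 ^ (n.size - 1) ≤ n := Nat.lt_size.1 (by omega)
  have hle : ((n.size - 1 : ℕ) : ℝ) * Real.log 2 ≤ Real.log n := by
    rw [← Real.log_pow]
    exact Real.log_le_log (by positivity) (by exact_mod_cast hpow)
  rw [Nat.cast_sub hpos, Nat.cast_one] at hle
  rw [Real.norm_of_nonneg (Nat.cast_nonneg _), Real.norm_of_nonneg (h2.le.trans hlog),
    div_mul_eq_mul_div, le_div_iff₀ h2]
  linarith

theorem isBigO_certificate_length {b : ℕ → ℕ}
    (hb : (fun n => (b n : ℝ)) =O[atTop] fun n : ℕ => Real.log n) :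
    (fun n => (((2 * (b n + 5 * n.size + 2) + 2) * (2 * n + 3) : ℕ) : ℝ)) =O[atTop]
      fun n : ℕ => (n : ℝ) * Real.log n := by
  have hlog : Tendsto (fun n : ℕ => Real.log n) atTop atTop :=
    Real.tendsto_log_atTop.comp tendsto_natCast_atTop_atTop
  have hconst : ∀ C : ℝ, (fun _ : ℕ => C) =O[atTop] fun n : ℕ => Real.log n := fun C =>
    (isLittleO_const_left.2 (Or.inr (tendsto_norm_atTop_atTop.comp hlog))).isBigO
  have hconst' : (fun _ : ℕ => (3 : ℝ)) =O[atTop] fun n : ℕ => (n : ℝ) :=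
    (isLittleO_const_left.2
      (Or.inr (tendsto_norm_atTop_atTop.comp tendsto_natCast_atTop_atTop))).isBigO
  have h1 : (fun n : ℕ => 2 * ((b n : ℝ) + 5 * n.size + 2) + 2) =O[atTop]
      fun n : ℕ => Real.log n :=
    (((hb.add (isBigO_size.const_mul_left 5)).add (hconst 2)).const_mul_left 2).add (hconst 2)
  have h2 : (fun n : ℕ => 2 * (n : ℝ) + 3) =O[atTop] fun n : ℕ => (n : ℝ) :=
    ((isBigO_refl _ _).const_mul_left 2).add hconst'
  refine ((h2.mul h1).congr_left fun n => ?_)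
  push_cast
  ring

end LocalCert

/-- There is a proof-labeling scheme with locality `1` that certifies `P₅`-freeness with
certificates of size `O(n log n)`. -/
theorem mainTheorem2 :
    LocalCert.HasPLS 1 (fun {V} G => LocalCert.PathFree (V := V) 5 G)
      (fun n : ℕ => (n : ℝ) * Real.log n) := by
  refine ⟨LocalCert.pathVerifier, fun b hb =>
    ⟨_, LocalCert.isBigO_certificate_length hb, fun V _ G ident hG hinj hid => ⟨fun hfree =>
      LocalCert.exists_accepting_certificates hG hinj _ hid hfree, fun hfree c => ?_⟩⟩⟩
  by_contra! hacc
  exact hfree (LocalCert.pathFree_of_check hinj fun v =>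
    (LocalCert.accepts_pathVerifier_iff G ident c v).1 (hacc v))
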